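/- Let $m,n\ge 1$ be integers, $1<p,q<\infty$, $\alpha,\beta,\gamma,\delta\in\mathbb R$, $p'=\frac{p}{p-1}$, and let $w_\gamma(x,y)=|(x,y)|^{-\gamma}$ and $v_\delta(x,y)=|(x,y)|^{\delta}$ for $(x,y)\in\mathbb R^m\times\mathbb R^n$, where $|(x,y)|=(|x|^2+|y|^2)^{1/2}$. Define the rectangle Muckenhoupt characteristic $$A=\sup_{I\subset\mathbb R^m,\,J\subset\mathbb R^n}|I|^{\frac{\alpha}{m}-1}|J|^{\frac{\beta}{n}-1}\Big(\iint_{I\times J}w_\gamma^{q}\Big)^{\frac1q}\Big(\iint_{I\times J}v_\delta^{-p'}\Big)^{\frac1{p'}}\in[0,\infty],$$ the supremum being over all (non-degenerate, axis-parallel) cubes $I$, $J$. Put $t_+=\max\{t,0\}$, $\Gamma=\frac1p-\frac1q$ and, for $k\in\{m,n\}$, $$\Delta(k)=\Delta^{\gamma,\delta}_{p,q}(k)=\Big(\gamma-\frac kq\Big)_+ +\Big(\delta-\frac k{p'}\Big)_+ .$$ The weight $w_\gamma^q$ is locally integrable if and only if $\gamma q<m+n$, and $v_\delta^{-p'}$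 is locally integrable if and only if $\delta p'<m+n$. Moreover $A<\infty$ if and only if all of the following hold: 1. $\gamma q<m+n$ and $\delta p'<m+n$ (local integrability of $w_\gamma^q$ and $v_\delta^{-p'}$); 2. $\displaystyle \Gamma=\frac{\alpha+\beta-\gamma-\delta}{m+n}$; 3. $\displaystyle \Gamma+\frac{\Delta(n)}{m}\le\frac{\alpha}{m}\le\Gamma+\frac{\gamma+\delta}{m}-\frac{\Delta(m)}{m}$; 4. $\displaystyle \Gamma+\frac{\Delta(m)}{n}\le\frac{\beta}{n}\le\Gamma+\frac{\gamma+\delta}{n}-\frac{\Delta(n)}{n}$; where, in 3 and 4, each inequality containing $\Delta(k)$ ($k=m$ or $k=n$) is to be read as a strict inequality whenever $\gamma=\frac kq$ or $\delta=\frac k{p'}$. -/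

import Mathlib

open MeasureTheory
open scoped ENNReal

noncomputable section

/-- The product space `ℝᵐ × ℝⁿ` of two Euclidean spaces, with Lebesgue (product) measure. -/
abbrev ProdSpace (m n : ℕ) : Type := EuclideanSpace ℝ (Fin m) × EuclideanSpace ℝ (Fin n)

/-- The closed cube `∏ᵢ [aᵢ, aᵢ + s]` in `ℝᵏ`, with sides parallel to the axes. -/
def cube {k : ℕ} (a : EuclideanSpace ℝ (Fin k)) (s : ℝ) : Set (EuclideanSpace ℝ (Fin k)) :=
  {x | ∀ i, a i ≤ x i ∧ x i ≤ a i + s}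

/-- The product Muckenhoupt characteristic `A_{p,q}^{(α,β),(m,n)}(v,w)`: the supremum over all
cubes `I ⊆ ℝᵐ`, `J ⊆ ℝⁿ` of positive side length of
`|I|^{α/m-1} |J|^{β/n-1} (∬_{I×J} w^q)^{1/q} (∬_{I×J} v^{-p'})^{1/p'}`, with `p' = p/(p-1)`. -/
def muckenhouptChar (m n : ℕ) (α β p q : ℝ) (v w : ProdSpace m n → ℝ≥0∞) : ℝ≥0∞ :=
  ⨆ (a : EuclideanSpace ℝ (Fin m)) (b : EuclideanSpace ℝ (Fin n))
    (s : ℝ) (_ : 0 < s) (t : ℝ) (_ : 0 < t),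
    volume (cube a s) ^ (α / m - 1) * volume (cube b t) ^ (β / n - 1)
      * (∫⁻ z in cube a s ×ˢ cube b t, w z ^ q) ^ (1 / q)
      * (∫⁻ z in cube a s ×ˢ cube b t, v z ^ (-p.conjExponent)) ^ (1 / p.conjExponent)

/-- The power weight `|(x,y)|^κ = (|x|² + |y|²)^{κ/2}` on `ℝᵐ × ℝⁿ`, with values in `[0,∞]`
(at the origin it is `∞` if `κ < 0`). -/
def powerWeight (m n : ℕ) (κ : ℝ) (z : ProdSpace m n) : ℝ≥0∞ :=
  ENNReal.ofReal (Real.sqrt (‖z.1‖ ^ 2 + ‖z.2‖ ^ 2)) ^ κ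

/-- `Δ_{p,q}^{γ,δ}(k) = (γ - k/q)₊ + (δ - k/p')₊`. -/
def triangleIndex (p q γ δ : ℝ) (k : ℕ) : ℝ :=
  max (γ - k / q) 0 + max (δ - k / p.conjExponent) 0

/-- One of the two positive parts in `Δ_{p,q}^{γ,δ}(k)` is the positive part of zero. -/
def IsCritical (p q γ δ : ℝ) (k : ℕ) : Prop :=
  γ - k / q = 0 ∨ δ - k / p.conjExponent = 0

/-- The inequality `A ≤ B`, which is to be read as the strict inequality `A < B` when `c` holds.
This is the convention that `0₊ ≤ A` means `0 < A`. -/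
def LeStrictIf (c : Prop) (A B : ℝ) : Prop :=
  A ≤ B ∧ (c → A < B)

end

/-! Write the side lengths as e^σ, e^τ and put κ₁ = γq, κ₂ = δp', r₁ = 1/q, r₂ = 1/p'. Since r₁ + r₂
= 1 - Γ, the numbers X = α - mΓ and Y = β - nΓ collect the volume powers. Homogeneity reads X + Y =
γ + δ; it turns each upper bound on one of X, Y into the lower bound on the other, so beyond local
integrability what remains is Δ(n) ≤ X and Δ(m) ≤ Y, strict in the critical cases.

Sufficiency: by symmetry let σ ≤ τ. Far from the origin, at distance e^η, both weights are
essentially constant and the quantity is comparable to e^{-X(η-σ)-Y(η-τ)}, bounded because X, Y ≥ 0.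
Near the origin, ∬|z|^{-κ} ≲ e^{mσ+nτ-κτ+e(τ-σ)} for every e ≥ (κ-n)₊, with e > 0 if κ = n
(`exists_lintegral_powerWeight_le`). The condition on X is exactly what allows exponents e₁, e₂ with
e₁r₁ + e₂r₂ = X, and then all powers cancel (`exists_rectangle_bound`).

Necessity: test on products of centred balls. One annulus gives the matching lower estimate with e =
(κ-n)₊. Taking σ = τ of either sign forces homogeneity, and σ → -∞ with τ = 0 forces the bound on X.
When κ = n all dyadic annuli contribute equally, and this logarithmic divergence excludes equality
(`BallProdBound.lt_of_eq`). -/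

/-- The exponential `e^u` as an extended nonnegative real. -/
noncomputable def expE (u : ℝ) : ℝ≥0∞ := ENNReal.ofReal (Real.exp u)

theorem expE_add (u v : ℝ) : expE (u + v) = expE u * expE v := by
  rw [expE, Real.exp_add, ENNReal.ofReal_mul (Real.exp_pos u).le]; rfl

theorem expE_rpow (u r : ℝ) : expE u ^ r = expE (u * r) := by
  rw [expE, ENNReal.ofReal_rpow_of_pos (Real.exp_pos u), ← Real.exp_mul]; rfl

theorem expE_pow (u : ℝ) (k : ℕ) : expE u ^ k = expE (k * u) := by
  rw [← ENNReal.rpow_natCast, expE_rpow, mul_comm]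

theorem expE_le_expE {u v : ℝ} : expE u ≤ expE v ↔ u ≤ v := by
  rw [expE, expE, ENNReal.ofReal_le_ofReal_iff (Real.exp_pos v).le, Real.exp_le_exp]

theorem expE_ne_top (u : ℝ) : expE u ≠ ⊤ := ENNReal.ofReal_ne_top

theorem expE_pos (u : ℝ) : 0 < expE u := ENNReal.ofReal_pos.2 (Real.exp_pos u)

theorem exists_le_expE {x : ℝ≥0∞} (hx : x < ⊤) : ∃ u, x ≤ expE u := by
  obtain ⟨n, hn⟩ := ENNReal.exists_nat_gt hx.ne
  refine ⟨n, hn.le.trans ?_⟩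
  rw [expE, ← ENNReal.ofReal_natCast]
  exact ENNReal.ofReal_le_ofReal (by linarith [Real.add_one_le_exp (n : ℝ)])

theorem exists_eq_expE {x : ℝ≥0∞} (h0 : x ≠ 0) (hx : x ≠ ⊤) : ∃ u, x = expE u :=
  ⟨Real.log x.toReal, by
    rw [expE, Real.exp_log (ENNReal.toReal_pos h0 hx), ENNReal.ofReal_toReal hx]⟩

theorem ENNReal.rpow_le_rpow_of_nonpos {x y : ℝ≥0∞} {r : ℝ} (hr : r ≤ 0) (h : x ≤ y) :
    y ^ r ≤ x ^ r := by
  rw [← neg_neg r, ENNReal.rpow_neg y, ENNReal.rpow_neg x, ENNReal.inv_le_inv]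
  exact ENNReal.rpow_le_rpow h (neg_nonneg.2 hr)

theorem ofReal_rpow_le_expE {r η d : ℝ} (κ : ℝ) (h1 : Real.exp (η - d) ≤ r)
    (h2 : r ≤ Real.exp (η + d)) : ENNReal.ofReal r ^ (-κ) ≤ expE (-κ * η + |κ| * d) := by
  rcases le_total κ 0 with hκ | hκ
  · calc _ ≤ expE (η + d) ^ (-κ) :=
          ENNReal.rpow_le_rpow (ENNReal.ofReal_le_ofReal h2) (by linarith)
      _ = _ := by rw [expE_rpow, abs_of_nonpos hκ]; congr 1; ring
  · calc _ ≤ expE (η - d) ^ (-κ) :=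
          ENNReal.rpow_le_rpow_of_nonpos (by linarith) (ENNReal.ofReal_le_ofReal h1)
      _ = _ := by rw [expE_rpow, abs_of_nonneg hκ]; congr 1; ring

theorem expE_le_ofReal_rpow {r η d : ℝ} (κ : ℝ) (h1 : Real.exp (η - d) ≤ r)
    (h2 : r ≤ Real.exp (η + d)) : expE (-κ * η - |κ| * d) ≤ ENNReal.ofReal r ^ (-κ) := by
  rcases le_total κ 0 with hκ | hκ
  · calc _ = expE (η - d) ^ (-κ) := by rw [expE_rpow, abs_of_nonpos hκ]; congr 1; ring
      _ ≤ _ := ENNReal.rpow_le_rpow (ENNReal.ofReal_le_ofReal h1) (by linarith)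
  · calc _ = expE (η + d) ^ (-κ) := by rw [expE_rpow, abs_of_nonneg hκ]; congr 1; ring
      _ ≤ _ := ENNReal.rpow_le_rpow_of_nonpos (by linarith) (ENNReal.ofReal_le_ofReal h2)

/-! ### Scaling and radial power integrals for Haar measure. -/

section Haar

variable {E : Type*} [NormedAddCommGroup E] [NormedSpace ℝ E] [FiniteDimensional ℝ E]
  [MeasurableSpace E] [BorelSpace E] (μ : Measure E) [μ.IsAddHaarMeasure]

theorem lintegral_eq_expE_mul_lintegral_smul (f : E → ℝ≥0∞) (σ : ℝ) :
    ∫⁻ x, f x ∂μ = expE (Module.finrank ℝ E * σ) * ∫⁻ x, f (Real.exp σ • x) ∂μ := by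
  have h0 : Real.exp σ ≠ 0 := (Real.exp_pos σ).ne'
  have hemb : MeasurableEmbedding (fun x : E => Real.exp σ • x) :=
    (Homeomorph.smulOfNeZero _ h0).measurableEmbedding
  have h := hemb.lintegral_map (μ := μ) f
  rw [Measure.map_addHaar_smul μ h0, lintegral_smul_measure] at h
  rw [← h, smul_eq_mul, ← mul_assoc]
  have : ENNReal.ofReal |(Real.exp σ ^ Module.finrank ℝ E)⁻¹|
      = expE (-(Module.finrank ℝ E * σ)) := by
    rw [abs_of_pos (by positivity), ← Real.exp_nat_mul, ← Real.exp_neg]; rfl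
  rw [this, ← expE_add, add_neg_cancel]
  simp [expE]

theorem exists_addHaar_closedBall_eq_expE :
    ∃ c, ∀ (x : E) (σ : ℝ),
      μ (Metric.closedBall x (Real.exp σ)) = expE (c + Module.finrank ℝ E * σ) := by
  obtain ⟨c, hc⟩ := exists_eq_expE (x := μ (Metric.ball 0 1))
    (Metric.measure_ball_pos μ _ one_pos).ne' measure_ball_lt_top.ne
  refine ⟨c, fun x σ => ?_⟩
  rw [Measure.addHaar_closedBall μ x (Real.exp_pos σ).le, hc, ← Real.exp_nat_mul, add_comm,
    expE_add]
  rfl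

/-- Polar coordinates reduce this to integrability of r^(d-1-a) on (0,1). -/
theorem lintegral_ball_rpow_norm_lt_top_iff [Nontrivial E] (a : ℝ) :
    ∫⁻ x in Metric.ball (0 : E) 1, ENNReal.ofReal ‖x‖ ^ (-a) ∂μ < ⊤
      ↔ a < Module.finrank ℝ E := by
  have hd : 1 ≤ Module.finrank ℝ E := Module.finrank_pos
  have key := integrableOn_fun_norm_addHaar μ (E := E) (F := ℝ) (f := fun y => y ^ (-a)) (r := 1)
  have h2 : IntegrableOn (fun y : ℝ => y ^ (Module.finrank ℝ E - 1) • y ^ (-a)) (Set.Ioo 0 1)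
      ↔ a < Module.finrank ℝ E := by
    rw [integrableOn_congr_fun (g := fun y : ℝ => y ^ ((Module.finrank ℝ E : ℝ) - 1 - a)) _
      measurableSet_Ioo, intervalIntegral.integrableOn_Ioo_rpow_iff one_pos]
    · constructor <;> intro h <;> linarith
    · intro y hy
      simp only [smul_eq_mul]
      rw [← Real.rpow_natCast, ← Real.rpow_add hy.1]
      congr 1
      push_cast [hd]
      ring
  have hm : AEStronglyMeasurable (fun x : E => ‖x‖ ^ (-a)) (μ.restrict (Metric.ball 0 1)) := by
    apply Measurable.aestronglyMeasurable
    fun_prop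
  rw [← h2, ← key, IntegrableOn, Integrable, and_iff_right hm,
    hasFiniteIntegral_iff_ofReal (Filter.Eventually.of_forall fun x => by positivity)]
  have : ∫⁻ x in Metric.ball (0 : E) 1, ENNReal.ofReal ‖x‖ ^ (-a) ∂μ
      = ∫⁻ x in Metric.ball (0 : E) 1, ENNReal.ofReal (‖x‖ ^ (-a)) ∂μ := by
    -- For a > 0 the extended power is infinite at the origin while the real one is 0, so the
    -- integrands agree only almost everywhere.
    apply lintegral_congr_ae
    have h0 : ∀ᵐ x ∂μ.restrict (Metric.ball 0 1), x ≠ (0 : E) :=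
      ae_restrict_of_ae (by simp [ae_iff, measure_singleton])
    filter_upwards [h0] with x hx
    exact ENNReal.ofReal_rpow_of_pos (norm_pos_iff.2 hx)
  rw [this]

end Haar

/-- Integration over a cube of a power singularity of order below the dimension. -/
theorem exists_lintegral_rpow_norm_le {E : Type*} [NormedAddCommGroup E] [NormedSpace ℝ E]
    [FiniteDimensional ℝ E] [MeasurableSpace E] [BorelSpace E] (μ : Measure E)
    [μ.IsAddHaarMeasure] [Nontrivial E] {a : ℝ} (ha : 0 ≤ a) (had : a < Module.finrank ℝ E) :
    ∃ c, ∀ (S : Set E) (σ : ℝ), μ S ≤ expE (Module.finrank ℝ E * σ) →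
      ∫⁻ x in S, ENNReal.ofReal ‖x‖ ^ (-a) ∂μ ≤ expE (c + (Module.finrank ℝ E - a) * σ) := by
  obtain ⟨c, hc⟩ := exists_le_expE ((lintegral_ball_rpow_norm_lt_top_iff μ (E := E) a).2 had)
  -- This constant is log(e^c + 1): e^c comes from inside the ball of radius e^σ, and 1 from
  -- outside, where the integrand is at most e^{-aσ}.
  refine ⟨c + Real.log (1 + Real.exp (-c)), fun S σ hS => ?_⟩
  have hball : ∫⁻ x in Metric.ball (0 : E) (Real.exp σ), ENNReal.ofReal ‖x‖ ^ (-a) ∂μ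
      ≤ expE (c + (Module.finrank ℝ E - a) * σ) := by
    rw [← lintegral_indicator measurableSet_ball, lintegral_eq_expE_mul_lintegral_smul μ _ σ]
    have : ∀ x : E, (Metric.ball (0 : E) (Real.exp σ)).indicator
        (fun x => ENNReal.ofReal ‖x‖ ^ (-a)) (Real.exp σ • x)
        = expE (-a * σ) * (Metric.ball (0 : E) 1).indicator
          (fun x => ENNReal.ofReal ‖x‖ ^ (-a)) x := by
      intro x
      have hmem : Real.exp σ • x ∈ Metric.ball (0 : E) (Real.exp σ) ↔ x ∈ Metric.ball (0 : E) 1 := by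
        simp [norm_smul, Real.exp_pos]
      by_cases hx : x ∈ Metric.ball (0 : E) 1
      · rw [Set.indicator_of_mem (hmem.2 hx), Set.indicator_of_mem hx, norm_smul,
          Real.norm_of_nonneg (Real.exp_pos σ).le, ENNReal.ofReal_mul (Real.exp_pos σ).le,
          ENNReal.mul_rpow_of_ne_top ENNReal.ofReal_ne_top ENNReal.ofReal_ne_top]
        congr 1
        exact (expE_rpow σ (-a)).trans (by rw [mul_comm])
      · rw [Set.indicator_of_notMem (mt hmem.1 hx), Set.indicator_of_notMem hx, mul_zero]
    simp_rw [this]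
    rw [lintegral_const_mul' _ _ (expE_ne_top _), lintegral_indicator measurableSet_ball,
      ← mul_assoc, ← expE_add]
    refine (mul_le_mul_right hc _).trans ?_
    rw [← expE_add, expE_le_expE]
    linarith
  calc ∫⁻ x in S, ENNReal.ofReal ‖x‖ ^ (-a) ∂μ
      ≤ ∫⁻ x in S ∩ Metric.ball (0 : E) (Real.exp σ), ENNReal.ofReal ‖x‖ ^ (-a) ∂μ
        + ∫⁻ x in S \ Metric.ball (0 : E) (Real.exp σ), ENNReal.ofReal ‖x‖ ^ (-a) ∂μ :=
        (lintegral_inter_add_sdiff _ _ measurableSet_ball).ge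
    _ ≤ expE (c + (Module.finrank ℝ E - a) * σ) + expE (-a * σ) * μ S := by
        gcongr
        · exact (lintegral_mono_set Set.inter_subset_right).trans hball
        · calc _ ≤ ∫⁻ x in S \ Metric.ball (0 : E) (Real.exp σ), expE (-a * σ) ∂μ := by
                refine lintegral_mono_ae ?_
                have hd : ∀ᵐ x ∂μ.restrict (S \ Metric.ball (0 : E) (Real.exp σ)),
                    x ∈ (Metric.ball (0 : E) (Real.exp σ))ᶜ :=
                  ae_mono (Measure.restrict_mono_set μ (fun x hx => hx.2))
                    (ae_restrict_mem measurableSet_ball.compl)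
                filter_upwards [hd] with x hx
                have hx : Real.exp σ ≤ ‖x‖ := by simpa using hx
                calc ENNReal.ofReal ‖x‖ ^ (-a) ≤ expE σ ^ (-a) :=
                      ENNReal.rpow_le_rpow_of_nonpos (by linarith) (ENNReal.ofReal_le_ofReal hx)
                  _ = _ := by rw [expE_rpow, mul_comm]
            _ ≤ _ := by
                rw [setLIntegral_const]
                gcongr
                exact Set.sdiff_subset
    _ ≤ expE (c + (Module.finrank ℝ E - a) * σ) + expE ((Module.finrank ℝ E - a) * σ) := by
        gcongr
        refine (mul_le_mul_right hS _).trans ?_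
        rw [← expE_add, expE_le_expE]
        linarith
    _ = _ := by
        have h1 : 0 < 1 + Real.exp (-c) := by positivity
        rw [expE, expE, expE, ← ENNReal.ofReal_add (Real.exp_pos _).le (Real.exp_pos _).le]
        congr 1
        rw [add_right_comm c, Real.exp_add (c + _), Real.exp_log h1, mul_add, mul_one,
          ← Real.exp_add]
        ring_nf

/-! ### Geometry of the radius and of cubes; slices of the power weight. -/

/-- The Euclidean distance to the origin in `ℝᵐ × ℝⁿ`. -/
noncomputable def rad {m n : ℕ} (z : ProdSpace m n) : ℝ := Real.sqrt (‖z.1‖ ^ 2 + ‖z.2‖ ^ 2)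

theorem powerWeight_eq (m n : ℕ) (κ : ℝ) (z : ProdSpace m n) :
    powerWeight m n κ z = ENNReal.ofReal (rad z) ^ κ := rfl

theorem norm_fst_le_rad {m n : ℕ} (z : ProdSpace m n) : ‖z.1‖ ≤ rad z :=
  Real.le_sqrt_of_sq_le (by nlinarith [sq_nonneg ‖z.2‖])

theorem norm_snd_le_rad {m n : ℕ} (z : ProdSpace m n) : ‖z.2‖ ≤ rad z :=
  Real.le_sqrt_of_sq_le (by nlinarith [sq_nonneg ‖z.1‖])

theorem rad_le_add {m n : ℕ} (z : ProdSpace m n) : rad z ≤ ‖z.1‖ + ‖z.2‖ :=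
  (Real.sqrt_le_left (by positivity)).2
    (by nlinarith [mul_nonneg (norm_nonneg z.1) (norm_nonneg z.2)])

theorem rad_le_rad_add {m n : ℕ} (z w : ProdSpace m n) :
    rad z ≤ rad w + (‖z.1 - w.1‖ + ‖z.2 - w.2‖) := by
  have h1 : ‖z.1‖ ≤ ‖w.1‖ + ‖z.1 - w.1‖ := norm_le_insert' _ _
  have h2 : ‖z.2‖ ≤ ‖w.2‖ + ‖z.2 - w.2‖ := norm_le_insert' _ _
  have hw : rad w ^ 2 = ‖w.1‖ ^ 2 + ‖w.2‖ ^ 2 := Real.sq_sqrt (by positivity)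
  have h3 := norm_fst_le_rad w
  have h4 := norm_snd_le_rad w
  have h5 : 0 ≤ rad w := Real.sqrt_nonneg _
  refine (Real.sqrt_le_left (by positivity)).2 ?_
  have e1 : ‖z.1‖ ^ 2 ≤ (‖w.1‖ + ‖z.1 - w.1‖) ^ 2 := by gcongr
  have e2 : ‖z.2‖ ^ 2 ≤ (‖w.2‖ + ‖z.2 - w.2‖) ^ 2 := by gcongr
  nlinarith [mul_le_mul_of_nonneg_right h3 (norm_nonneg (z.1 - w.1)),
    mul_le_mul_of_nonneg_right h4 (norm_nonneg (z.2 - w.2)),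
    mul_nonneg (norm_nonneg (z.1 - w.1)) (norm_nonneg (z.2 - w.2))]

theorem measurable_powerWeight (m n : ℕ) (κ : ℝ) : Measurable (powerWeight m n κ) := by
  unfold powerWeight
  fun_prop

theorem measurableSet_cube {k : ℕ} (a : EuclideanSpace ℝ (Fin k)) (s : ℝ) :
    MeasurableSet (cube a s) := by
  have : IsClosed (cube a s) := by
    simp only [cube, Set.ofPred_forall, Set.ofPred_and]
    refine isClosed_iInter fun i => IsClosed.inter ?_ ?_
    · exact isClosed_le continuous_const (by fun_prop)
    · exact isClosed_le (by fun_prop) continuous_const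
  exact this.measurableSet

theorem volume_cube {k : ℕ} (a : EuclideanSpace ℝ (Fin k)) (σ : ℝ) :
    volume (cube a (Real.exp σ)) = expE (k * σ) := by
  have h : cube a (Real.exp σ) = WithLp.ofLp ⁻¹'
      (Set.Icc (fun i => a i) (fun i => a i + Real.exp σ)) := by
    ext x
    simp [cube, Set.mem_Icc, Pi.le_def, forall_and]
  rw [h, (PiLp.volume_preserving_ofLp (Fin k)).measure_preimage
    measurableSet_Icc.nullMeasurableSet, Real.volume_Icc_pi]
  simp only [add_sub_cancel_left, Finset.prod_const, Finset.card_univ, Fintype.card_fin]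
  exact expE_pow σ k

theorem self_mem_cube {k : ℕ} (a : EuclideanSpace ℝ (Fin k)) {s : ℝ} (hs : 0 ≤ s) :
    a ∈ cube a s := fun i => ⟨le_rfl, by linarith⟩

theorem norm_sub_le_of_mem_cube {k : ℕ} {a x y : EuclideanSpace ℝ (Fin k)} {s : ℝ} (hs : 0 ≤ s)
    (hx : x ∈ cube a s) (hy : y ∈ cube a s) : ‖x - y‖ ≤ k * s := by
  rw [EuclideanSpace.norm_eq]
  refine (Real.sqrt_le_left (by positivity)).2 ?_
  calc ∑ i, ‖(x - y) i‖ ^ 2 ≤ ∑ _i : Fin k, s ^ 2 := by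
        refine Finset.sum_le_sum fun i _ => ?_
        have h1 := hx i
        have h2 := hy i
        have : |x i - y i| ≤ s := abs_le.2 ⟨by linarith, by linarith⟩
        rw [Real.norm_eq_abs]
        exact pow_le_pow_left₀ (abs_nonneg _) this 2
    _ = k * s ^ 2 := by simp
    _ ≤ (k * s) ^ 2 := by
        have : (k : ℝ) ≤ (k : ℝ) ^ 2 := by exact_mod_cast Nat.le_self_pow two_ne_zero k
        nlinarith [sq_nonneg s]

theorem closedBall_subset_cube {k : ℕ} (ρ : ℝ) :
    Metric.closedBall 0 ρ ⊆ cube (WithLp.toLp 2 fun _ : Fin k => -ρ) (2 * ρ) := by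
  intro x hx i
  have h1 : ‖x‖ ≤ ρ := by simpa using hx
  have h2 : |x i| ≤ ρ := (PiLp.norm_apply_le x i).trans h1
  have h3 := abs_le.1 h2
  exact ⟨h3.1, by change x i ≤ -ρ + 2 * ρ; linarith⟩

/-- The weight is symmetric in the two factors, which reduces every estimate to σ ≤ τ. -/
theorem setLIntegral_powerWeight_swap (m n : ℕ) (κ : ℝ) (S : Set (EuclideanSpace ℝ (Fin m)))
    (T : Set (EuclideanSpace ℝ (Fin n))) :
    ∫⁻ z in S ×ˢ T, powerWeight m n κ z = ∫⁻ z in T ×ˢ S, powerWeight n m κ z := by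
  have h : MeasurePreserving (Prod.swap : ProdSpace m n → ProdSpace n m) volume volume :=
    Measure.measurePreserving_swap
  rw [← h.setLIntegral_comp_preimage_emb MeasurableEquiv.prodComm.measurableEmbedding,
    Set.preimage_swap_prod]
  refine lintegral_congr fun z => ?_
  simp only [powerWeight, Prod.fst_swap, Prod.snd_swap]
  rw [add_comm]

theorem setLIntegral_prod_le_mul {m n : ℕ} {S : Set (EuclideanSpace ℝ (Fin m))}
    {T : Set (EuclideanSpace ℝ (Fin n))} {F : ProdSpace m n → ℝ≥0∞}
    {f : EuclideanSpace ℝ (Fin m) → ℝ≥0∞} {g : EuclideanSpace ℝ (Fin n) → ℝ≥0∞}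
    (hf : Measurable f) (hg : Measurable g) (h : ∀ᵐ z, F z ≤ f z.1 * g z.2) :
    ∫⁻ z in S ×ˢ T, F z ≤ (∫⁻ x in S, f x) * ∫⁻ y in T, g y := by
  calc ∫⁻ z in S ×ˢ T, F z ≤ ∫⁻ z in S ×ˢ T, f z.1 * g z.2 :=
        lintegral_mono_ae (ae_restrict_of_ae h)
    _ = _ := by
        rw [Measure.volume_eq_prod, ← Measure.prod_restrict,
          lintegral_prod_mul hf.aemeasurable hg.aemeasurable]

/-- Substituting y = |x|y' extracts |x|^{n-κ} and leaves ∫(1+|y'|²)^{-κ/2}, finite because κ > n. -/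
theorem lintegral_powerWeight_snd {m n : ℕ} {κ : ℝ} (hκ : (n : ℝ) < κ) :
    ∃ c, ∀ x : EuclideanSpace ℝ (Fin m), x ≠ 0 →
      ∫⁻ y, powerWeight m n (-κ) (x, y) ≤ expE c * ENNReal.ofReal ‖x‖ ^ (-(κ - n)) := by
  have hfin : ∫⁻ y : EuclideanSpace ℝ (Fin n), ENNReal.ofReal ((1 + ‖y‖ ^ 2) ^ (-κ / 2)) < ⊤ := by
    have := integrable_rpow_neg_one_add_norm_sq (E := EuclideanSpace ℝ (Fin n)) (μ := volume)
      (r := κ) (by simpa using hκ)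
    exact (hasFiniteIntegral_iff_ofReal
      (Filter.Eventually.of_forall fun x => by positivity)).1 this.2
  obtain ⟨c, hc⟩ := exists_le_expE hfin
  refine ⟨c, fun x hx => ?_⟩
  have hx' : 0 < ‖x‖ := norm_pos_iff.2 hx
  obtain ⟨σ, hσ⟩ : ∃ σ, Real.exp σ = ‖x‖ := ⟨_, Real.exp_log hx'⟩
  rw [lintegral_eq_expE_mul_lintegral_smul volume _ σ]
  have : ∀ y : EuclideanSpace ℝ (Fin n), powerWeight m n (-κ) (x, Real.exp σ • y)
      = expE (-κ * σ) * ENNReal.ofReal ((1 + ‖y‖ ^ 2) ^ (-κ / 2)) := by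
    intro y
    have h1 : rad ((x, Real.exp σ • y) : ProdSpace m n) = Real.exp σ * Real.sqrt (1 + ‖y‖ ^ 2) := by
      rw [rad]
      simp only [norm_smul, Real.norm_eq_abs, abs_of_pos (Real.exp_pos σ)]
      rw [← hσ, ← Real.sqrt_sq (Real.exp_pos σ).le, ← Real.sqrt_mul (sq_nonneg _),
        Real.sqrt_sq (Real.exp_pos σ).le]
      congr 1
      ring
    have h2 : 0 < Real.sqrt (1 + ‖y‖ ^ 2) := Real.sqrt_pos.2 (by positivity)
    rw [powerWeight_eq, h1, ENNReal.ofReal_mul (Real.exp_pos σ).le,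
      ENNReal.mul_rpow_of_ne_top ENNReal.ofReal_ne_top ENNReal.ofReal_ne_top,
      ENNReal.ofReal_rpow_of_pos h2, Real.sqrt_eq_rpow, ← Real.rpow_mul (by positivity)]
    congr 1
    · exact (expE_rpow σ _).trans (by rw [mul_comm])
    · congr 2
      ring
  simp_rw [this]
  rw [lintegral_const_mul' _ _ (expE_ne_top _), ← mul_assoc, ← expE_add, mul_comm, ← hσ]
  refine mul_le_mul' hc (le_of_eq ?_)
  refine Eq.trans ?_ (expE_rpow σ _).symm
  simp only [finrank_euclideanSpace, Fintype.card_fin]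
  congr 1
  ring

/-! ### Upper bounds for the weight integral over a rectangle. -/

section Upper

variable {m n : ℕ}

theorem lintegral_const_cube_prod (a : EuclideanSpace ℝ (Fin m)) (b : EuclideanSpace ℝ (Fin n))
    {σ τ u : ℝ} {F : ProdSpace m n → ℝ≥0∞}
    (h : ∀ z ∈ cube a (Real.exp σ) ×ˢ cube b (Real.exp τ), F z ≤ expE u) :
    ∫⁻ z in cube a (Real.exp σ) ×ˢ cube b (Real.exp τ), F z ≤ expE (u + (m * σ + n * τ)) := by
  refine (setLIntegral_mono' ((measurableSet_cube a _).prod (measurableSet_cube b _)) h).trans ?_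
  rw [setLIntegral_const, Measure.volume_eq_prod, Measure.prod_prod, volume_cube, volume_cube,
    expE_add, expE_add]

theorem exists_lintegral_cube_rpow_norm_le (hm : 1 ≤ m) {a : ℝ} (ha : 0 ≤ a) (ham : a < m) :
    ∃ c, ∀ (x : EuclideanSpace ℝ (Fin m)) (σ : ℝ),
      ∫⁻ x in cube x (Real.exp σ), ENNReal.ofReal ‖x‖ ^ (-a) ≤ expE (c + (m - a) * σ) := by
  have : Nonempty (Fin m) := ⟨⟨0, hm⟩⟩
  obtain ⟨c, hc⟩ := exists_lintegral_rpow_norm_le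
    (volume : Measure (EuclideanSpace ℝ (Fin m))) ha (by simpa using ham)
  simp only [finrank_euclideanSpace, Fintype.card_fin] at hc
  exact ⟨c, fun x σ => hc _ σ (volume_cube x σ).le⟩

/-- The exponent e is the price of the eccentricity τ - σ. The bound on `rad` controls κ < 0, where
the weight grows with distance; for κ ≥ 0 the position of the rectangle does not matter. -/
theorem exists_lintegral_powerWeight_le (hm : 1 ≤ m) (hn : 1 ≤ n) {κ e : ℝ} (hκ : κ < m + n)
    (he : κ - n ≤ e) (he0 : 0 ≤ e) (hc : κ = n → 0 < e) (D : ℝ) :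
    ∃ c, ∀ (a : EuclideanSpace ℝ (Fin m)) (b : EuclideanSpace ℝ (Fin n)) (σ τ : ℝ), σ ≤ τ →
      (∀ z ∈ cube a (Real.exp σ) ×ˢ cube b (Real.exp τ), rad z ≤ Real.exp (D + τ)) →
      ∫⁻ z in cube a (Real.exp σ) ×ˢ cube b (Real.exp τ), powerWeight m n (-κ) z
        ≤ expE (c + m * σ + n * τ - κ * τ + e * (τ - σ)) := by
  have hm' : (1 : ℝ) ≤ m := by exact_mod_cast hm
  have hn' : (1 : ℝ) ≤ n := by exact_mod_cast hn
  rcases lt_or_ge κ 0 with hneg | hpos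
  · refine ⟨-κ * D, fun a b σ τ hst hD => ?_⟩
    refine (lintegral_const_cube_prod (u := (D + τ) * -κ) a b fun z hz => ?_).trans ?_
    · rw [← expE_rpow, powerWeight_eq]
      exact ENNReal.rpow_le_rpow (ENNReal.ofReal_le_ofReal (hD z hz)) (by linarith)
    · rw [expE_le_expE]
      nlinarith [mul_nonneg he0 (sub_nonneg.2 hst)]
  -- separate the variables whenever the exponent can be distributed
  have split : ∀ x y : ℝ, 0 ≤ x → x < m → 0 ≤ y → y < n → x + y = κ → x ≤ e →
      ∃ c, ∀ (a : EuclideanSpace ℝ (Fin m)) (b : EuclideanSpace ℝ (Fin n)) (σ τ : ℝ), σ ≤ τ →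
      (∀ z ∈ cube a (Real.exp σ) ×ˢ cube b (Real.exp τ), rad z ≤ Real.exp (D + τ)) →
      ∫⁻ z in cube a (Real.exp σ) ×ˢ cube b (Real.exp τ), powerWeight m n (-κ) z
        ≤ expE (c + m * σ + n * τ - κ * τ + e * (τ - σ)) := by
    intro x y hx hxm hy hyn hxy hxe
    obtain ⟨c1, h1⟩ := exists_lintegral_cube_rpow_norm_le hm hx hxm
    obtain ⟨c2, h2⟩ := exists_lintegral_cube_rpow_norm_le hn hy hyn
    refine ⟨c1 + c2, fun a b σ τ hst _ => ?_⟩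
    refine (setLIntegral_prod_le_mul (f := fun u => ENNReal.ofReal ‖u‖ ^ (-x))
      (g := fun u => ENNReal.ofReal ‖u‖ ^ (-y)) (by fun_prop) (by fun_prop) ?_).trans ?_
    · refine Filter.Eventually.of_forall fun z => ?_
      -- The origin is treated separately, since additivity of the exponent needs a nonzero base.
      rcases (show 0 ≤ rad z from Real.sqrt_nonneg _).eq_or_lt with h0 | h0
      · have e1 : ‖z.1‖ = 0 := le_antisymm (h0 ▸ norm_fst_le_rad z) (norm_nonneg _)
        have e2 : ‖z.2‖ = 0 := le_antisymm (h0 ▸ norm_snd_le_rad z) (norm_nonneg _)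
        simp only [powerWeight_eq, ← h0, e1, e2]
        rcases hx.eq_or_lt with rfl | hx0
        · rw [zero_add] at hxy
          simp [hxy]
        · rcases hy.eq_or_lt with rfl | hy0
          · rw [add_zero] at hxy
            simp [hxy]
          · rw [ENNReal.ofReal_zero, ENNReal.zero_rpow_of_neg (y := -x) (by linarith),
              ENNReal.zero_rpow_of_neg (y := -y) (by linarith), ENNReal.top_mul_top]
            exact le_top
      · rw [powerWeight_eq, ← hxy, neg_add, ENNReal.rpow_add _ _
          (ENNReal.ofReal_pos.2 h0).ne' ENNReal.ofReal_ne_top]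
        exact mul_le_mul'
          (ENNReal.rpow_le_rpow_of_nonpos (by linarith)
            (ENNReal.ofReal_le_ofReal (norm_fst_le_rad z)))
          (ENNReal.rpow_le_rpow_of_nonpos (by linarith)
            (ENNReal.ofReal_le_ofReal (norm_snd_le_rad z)))
    · refine (mul_le_mul' (h1 a σ) (h2 b τ)).trans ?_
      rw [← expE_add, expE_le_expE]
      have : x * (τ - σ) ≤ e * (τ - σ) := mul_le_mul_of_nonneg_right hxe (by linarith)
      subst hxy
      linarith
  rcases lt_trichotomy κ n with hlt | heq | hgt
  · exact split 0 κ le_rfl (by linarith) hpos hlt (by ring) he0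
  · have h0 := hc heq
    -- Moving a small part of the exponent to the first variable makes the power in y integrable.
    -- The cap 1/2 keeps that part below m and the remainder nonnegative.
    refine split (min e (1 / 2)) (κ - min e (1 / 2)) (by positivity)
      ((min_le_right _ _).trans_lt (by linarith)) ?_ ?_ (by ring) (min_le_left _ _)
    · linarith [min_le_right e (1 / 2)]
    · have : 0 < min e (1 / 2) := by positivity
      linarith
  · obtain ⟨c1, h1⟩ := lintegral_powerWeight_snd (m := m) hgt
    obtain ⟨c2, h2⟩ := exists_lintegral_cube_rpow_norm_le (a := κ - n) hm (by linarith)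
      (by linarith)
    refine ⟨c1 + c2, fun a b σ τ hst _ => ?_⟩
    have : Nonempty (Fin m) := ⟨⟨0, hm⟩⟩
    -- The y-integral converges at infinity, so it may be taken over all of ℝⁿ; the resulting power
    -- κ - n < m of |x| is integrable on cubes.
    calc _ ≤ ∫⁻ z in cube a (Real.exp σ) ×ˢ Set.univ, powerWeight m n (-κ) z :=
          lintegral_mono_set (Set.prod_mono le_rfl (Set.subset_univ _))
      _ = ∫⁻ x in cube a (Real.exp σ), ∫⁻ y, powerWeight m n (-κ) (x, y) := by
          rw [Measure.volume_eq_prod, setLIntegral_prod _ (measurable_powerWeight m n _).aemeasurable]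
          simp
      _ ≤ ∫⁻ x in cube a (Real.exp σ), expE c1 * ENNReal.ofReal ‖x‖ ^ (-(κ - n)) := by
          refine lintegral_mono_ae ?_
          have h0 : ∀ᵐ x ∂(volume.restrict (cube a (Real.exp σ))), x ≠ 0 :=
            ae_restrict_of_ae (by simp [ae_iff, measure_singleton])
          filter_upwards [h0] with x hx using h1 x hx
      _ ≤ _ := by
          rw [lintegral_const_mul' _ _ (expE_ne_top _)]
          refine (mul_le_mul_right (h2 a σ) _).trans ?_
          rw [← expE_add, expE_le_expE]
          nlinarith [mul_le_mul_of_nonneg_right he (sub_nonneg.2 hst)]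

end Upper

/-! ### Uniform bound over rectangles with σ ≤ τ. -/

section Sufficiency

variable {m n : ℕ}

theorem exists_rectangle_bound (hm : 1 ≤ m) (hn : 1 ≤ n) {κ₁ κ₂ r₁ r₂ A B : ℝ} (hr₁ : 0 < r₁)
    (hr₂ : 0 < r₂) (hκ₁ : κ₁ < m + n) (hκ₂ : κ₂ < m + n)
    (hsum : A + m * (r₁ + r₂) + (B + n * (r₁ + r₂)) = κ₁ * r₁ + κ₂ * r₂)
    (hA : max (κ₁ - n) 0 * r₁ + max (κ₂ - n) 0 * r₂ ≤ A + m * (r₁ + r₂))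
    (hA' : κ₁ = n ∨ κ₂ = n →
      max (κ₁ - n) 0 * r₁ + max (κ₂ - n) 0 * r₂ < A + m * (r₁ + r₂))
    (hB : 0 ≤ B + n * (r₁ + r₂)) :
    ∃ M, ∀ (a : EuclideanSpace ℝ (Fin m)) (b : EuclideanSpace ℝ (Fin n)) (σ τ : ℝ), σ ≤ τ →
      ∃ u v,
        ∫⁻ z in cube a (Real.exp σ) ×ˢ cube b (Real.exp τ), powerWeight m n (-κ₁) z ≤ expE u ∧
        ∫⁻ z in cube a (Real.exp σ) ×ˢ cube b (Real.exp τ), powerWeight m n (-κ₂) z ≤ expE v ∧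
        A * σ + B * τ + u * r₁ + v * r₂ ≤ M := by
  have hm' : (1 : ℝ) ≤ m := by exact_mod_cast hm
  have hn' : (1 : ℝ) ≤ n := by exact_mod_cast hn
  set X := A + m * (r₁ + r₂) with hX
  set Y := B + n * (r₁ + r₂) with hY
  set d₁ := max (κ₁ - n) 0 with hd₁
  set d₂ := max (κ₂ - n) 0 with hd₂
  have hd₁0 : 0 ≤ d₁ := le_max_right _ _
  have hd₂0 : 0 ≤ d₂ := le_max_right _ _
  have hX0 : 0 ≤ X := le_trans (by positivity) hA
  have hr : 0 < r₁ + r₂ := by linarith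
  -- The slack in the condition on X is shared equally between the two exponents, so that their
  -- weighted sum is exactly X.
  set ε := (X - (d₁ * r₁ + d₂ * r₂)) / (r₁ + r₂) with hε
  have hε0 : 0 ≤ ε := div_nonneg (by linarith) hr.le
  have hεr : (d₁ + ε) * r₁ + (d₂ + ε) * r₂ = X := by
    rw [hε]; field_simp; ring
  have hε1 : κ₁ = n ∨ κ₂ = n → 0 < ε := fun h => div_pos (by linarith [hA' h]) hr
  obtain ⟨c₁, h₁⟩ := exists_lintegral_powerWeight_le hm hn hκ₁ (e := d₁ + ε)
    (by linarith [le_max_left (κ₁ - n) 0]) (by linarith)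
    (fun h => by linarith [hε1 (Or.inl h)]) (Real.log (3 * (m + n)))
  obtain ⟨c₂, h₂⟩ := exists_lintegral_powerWeight_le hm hn hκ₂ (e := d₂ + ε)
    (by linarith [le_max_left (κ₂ - n) 0]) (by linarith)
    (fun h => by linarith [hε1 (Or.inr h)]) (Real.log (3 * (m + n)))
  refine ⟨max (c₁ * r₁ + c₂ * r₂) ((|κ₁| * Real.log 2) * r₁ + (|κ₂| * Real.log 2) * r₂),
    fun a b σ τ hst => ?_⟩
  have hexp : Real.exp σ ≤ Real.exp τ := Real.exp_le_exp.2 hst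
  have hτ0 := Real.exp_pos τ
  have hdist : ∀ z ∈ cube a (Real.exp σ) ×ˢ cube b (Real.exp τ),
      ∀ w ∈ cube a (Real.exp σ) ×ˢ cube b (Real.exp τ),
      rad z ≤ rad w + (m + n) * Real.exp τ := by
    intro z hz w hw
    have e1 := norm_sub_le_of_mem_cube (Real.exp_pos σ).le hz.1 hw.1
    have e2 := norm_sub_le_of_mem_cube (Real.exp_pos τ).le hz.2 hw.2
    have e3 : (m : ℝ) * Real.exp σ ≤ m * Real.exp τ := by gcongr
    linarith [rad_le_rad_add z w]
  have h0 : (a, b) ∈ cube a (Real.exp σ) ×ˢ cube b (Real.exp τ) :=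
    ⟨self_mem_cube a (Real.exp_pos σ).le, self_mem_cube b hτ0.le⟩
  -- The radius varies by at most (m+n)e^τ on the rectangle: near the origin it stays below
  -- 3(m+n)e^τ, and far away it stays within a factor 2 of `rad (a, b)`.
  rcases le_total (rad (a, b)) (2 * (m + n) * Real.exp τ) with hnear | hfar
  · have hD : ∀ z ∈ cube a (Real.exp σ) ×ˢ cube b (Real.exp τ),
        rad z ≤ Real.exp (Real.log (3 * (m + n)) + τ) := by
      intro z hz
      rw [Real.exp_add, Real.exp_log (by positivity)]
      linarith [hdist z hz _ h0]
    refine ⟨_, _, h₁ a b σ τ hst hD, h₂ a b σ τ hst hD, le_trans (le_of_eq ?_) (le_max_left _ _)⟩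
    have e1 : A = X - m * (r₁ + r₂) := by rw [hX]; ring
    have e2 : B = κ₁ * r₁ + κ₂ * r₂ - X - n * (r₁ + r₂) := by rw [← hsum, hY]; ring
    rw [e2, e1]
    linear_combination (τ - σ) * hεr
  · have hρ : Real.exp τ ≤ rad (a, b) := by nlinarith
    have hρ0 : 0 < rad (a, b) := hτ0.trans_le hρ
    obtain ⟨η, hη⟩ : ∃ η, Real.exp η = rad (a, b) := ⟨_, Real.exp_log hρ0⟩
    have hτη : τ ≤ η := Real.exp_le_exp.1 (hη ▸ hρ)
    have hbd : ∀ κ : ℝ, ∀ z ∈ cube a (Real.exp σ) ×ˢ cube b (Real.exp τ),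
        powerWeight m n (-κ) z ≤ expE (-κ * η + |κ| * Real.log 2) := by
      intro κ z hz
      refine ofReal_rpow_le_expE κ ?_ ?_
      · rw [Real.exp_sub, Real.exp_log two_pos, hη]
        change _ ≤ rad z
        linarith [hdist _ h0 z hz]
      · rw [Real.exp_add, Real.exp_log two_pos, hη]
        change rad z ≤ _
        linarith [hdist z hz _ h0]
    refine ⟨_, _, lintegral_const_cube_prod a b (hbd κ₁), lintegral_const_cube_prod a b (hbd κ₂),
      le_trans ?_ (le_max_right _ _)⟩
    have e1 : A = X - m * (r₁ + r₂) := by rw [hX]; ring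
    have e2 : B = Y - n * (r₁ + r₂) := by rw [hY]; ring
    have e3 : 0 ≤ X * (η - σ) := mul_nonneg hX0 (by linarith)
    have e4 : 0 ≤ Y * (η - τ) := mul_nonneg hB (by linarith)
    have e5 : (X + Y) * η = (κ₁ * r₁ + κ₂ * r₂) * η := by rw [hsum]
    rw [e1, e2]
    linarith

end Sufficiency

/-! ### Lower bounds on products of centred balls and their consequences. -/

section Necessity

variable {m n : ℕ}

/-- The product of the centred balls of radii `e^σ` and `e^τ`. -/
def ballProd (m n : ℕ) (σ τ : ℝ) : Set (ProdSpace m n) :=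
  Metric.closedBall 0 (Real.exp σ) ×ˢ Metric.closedBall 0 (Real.exp τ)

theorem exists_le_lintegral_annulus (m : ℕ) (hn : 1 ≤ n) (κ : ℝ) :
    ∃ c, ∀ σ τ : ℝ, σ ≤ τ → expE (c + m * σ + n * τ - κ * τ) ≤
      ∫⁻ z in (Metric.closedBall (0 : EuclideanSpace ℝ (Fin m)) (Real.exp σ)) ×ˢ
        (Metric.closedBall (0 : EuclideanSpace ℝ (Fin n)) (Real.exp τ) \
          Metric.closedBall 0 (Real.exp τ / 2)), powerWeight m n (-κ) z := by
  have : Nonempty (Fin n) := ⟨⟨0, hn⟩⟩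
  obtain ⟨c₁, h₁⟩ := exists_addHaar_closedBall_eq_expE
    (volume : Measure (EuclideanSpace ℝ (Fin m)))
  obtain ⟨c₂, h₂⟩ := exists_addHaar_closedBall_eq_expE
    (volume : Measure (EuclideanSpace ℝ (Fin n)))
  simp only [finrank_euclideanSpace, Fintype.card_fin] at h₁ h₂
  refine ⟨c₁ + c₂ - n * Real.log 8 - |κ| * Real.log 2, fun σ τ hst => ?_⟩
  have hτ0 := Real.exp_pos τ
  have hexp : Real.exp σ ≤ Real.exp τ := Real.exp_le_exp.2 hst
  -- A ball of radius e^τ/8 about a point of norm 3e^τ/4 lies inside the annulus.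
  obtain ⟨y, hy⟩ := exists_norm_eq (EuclideanSpace ℝ (Fin n))
    (show 0 ≤ 3 / 4 * Real.exp τ by positivity)
  have hsub : Metric.closedBall y (Real.exp (τ - Real.log 8)) ⊆
      Metric.closedBall (0 : EuclideanSpace ℝ (Fin n)) (Real.exp τ) \
        Metric.closedBall 0 (Real.exp τ / 2) := by
    intro x hx
    rw [Real.exp_sub, Real.exp_log (by norm_num), mem_closedBall_iff_norm] at hx
    have e1 : ‖x‖ ≤ ‖y‖ + ‖x - y‖ := norm_le_insert' _ _
    have e2 : ‖y‖ ≤ ‖x‖ + ‖x - y‖ := norm_le_insert _ _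
    simp only [Set.mem_sdiff, mem_closedBall_zero_iff, not_le]
    constructor <;> linarith
  have hmeas : MeasurableSet ((Metric.closedBall (0 : EuclideanSpace ℝ (Fin m)) (Real.exp σ)) ×ˢ
      (Metric.closedBall (0 : EuclideanSpace ℝ (Fin n)) (Real.exp τ) \
          Metric.closedBall 0 (Real.exp τ / 2))) :=
    measurableSet_closedBall.prod (measurableSet_closedBall.diff measurableSet_closedBall)
  refine le_trans ?_ (setLIntegral_mono' (f := fun _ => expE (-κ * τ - |κ| * Real.log 2))
    hmeas fun z hz => ?_)
  · rw [setLIntegral_const, Measure.volume_eq_prod, Measure.prod_prod, h₁]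
    refine le_trans (le_of_eq ?_) (mul_le_mul_right (mul_le_mul_right (measure_mono hsub) _) _)
    rw [h₂, ← expE_add, ← expE_add]
    congr 1
    ring
  · have hz1 := hz.1
    have hz2 := hz.2
    simp only [Set.mem_sdiff, mem_closedBall_zero_iff, not_le] at hz1 hz2
    refine expE_le_ofReal_rpow κ ?_ ?_
    · rw [Real.exp_sub, Real.exp_log two_pos]
      exact hz2.2.le.trans (norm_snd_le_rad z)
    · rw [Real.exp_add, Real.exp_log two_pos]
      have := rad_le_add z
      change rad z ≤ _
      linarith

theorem exists_le_lintegral_ballProd (m : ℕ) (hn : 1 ≤ n) (κ : ℝ) :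
    ∃ c, ∀ σ τ : ℝ, σ ≤ τ → expE (c + m * σ + n * τ - κ * τ + max (κ - n) 0 * (τ - σ)) ≤
      ∫⁻ z in ballProd m n σ τ, powerWeight m n (-κ) z := by
  obtain ⟨c, hc⟩ := exists_le_lintegral_annulus m hn κ
  refine ⟨c, fun σ τ hst => ?_⟩
  rcases le_total (κ - n) 0 with h | h
  · rw [max_eq_right h, zero_mul, add_zero]
    exact (hc σ τ hst).trans (lintegral_mono_set (Set.prod_mono le_rfl Set.sdiff_subset))
  · rw [max_eq_left h]
    -- When κ ≥ n the mass concentrates near the origin, so the annulus at the smaller scale σ is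
    -- used.
    refine le_trans (le_of_eq ?_) ((hc σ σ le_rfl).trans (lintegral_mono_set
      (Set.prod_mono le_rfl (Set.sdiff_subset.trans
        (Metric.closedBall_subset_closedBall (Real.exp_le_exp.2 hst))))))
    congr 1
    ring

/-- At κ = n the annulus bound does not depend on τ, so k disjoint dyadic annuli contribute k equal
terms. -/
theorem exists_nat_mul_le_lintegral_ballProd (m : ℕ) (hn : 1 ≤ n) :
    ∃ c, ∀ (σ : ℝ) (k : ℕ), (k : ℝ≥0∞) * expE (c + m * σ) ≤
      ∫⁻ z in ballProd m n σ (σ + k * Real.log 2), powerWeight m n (-n) z := by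
  obtain ⟨c, hc⟩ := exists_le_lintegral_annulus m hn n
  refine ⟨c, fun σ k => ?_⟩
  induction k with
  | zero => simp
  | succ k ih =>
    have hl : 0 < Real.log 2 := Real.log_pos one_lt_two
    set τ := σ + (k + 1 : ℕ) * Real.log 2 with hτ
    have hτ' : Real.exp (σ + k * Real.log 2) = Real.exp τ / 2 := by
      rw [eq_div_iff two_ne_zero, ← Real.exp_log two_pos, ← Real.exp_add, hτ,
        Real.exp_log two_pos]
      push_cast
      ring_nf
    have hann := hc σ τ (by rw [hτ]; linarith [show 0 ≤ ((k + 1 : ℕ) : ℝ) * Real.log 2 by positivity])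
    have heq : ballProd m n σ τ = ballProd m n σ (σ + k * Real.log 2) ∪
        (Metric.closedBall (0 : EuclideanSpace ℝ (Fin m)) (Real.exp σ)) ×ˢ
        (Metric.closedBall (0 : EuclideanSpace ℝ (Fin n)) (Real.exp τ) \
          Metric.closedBall 0 (Real.exp τ / 2)) := by
      rw [ballProd, ballProd, hτ', ← Set.prod_union, Set.union_sdiff_cancel]
      exact Metric.closedBall_subset_closedBall (by linarith [Real.exp_pos τ])
    have hdisj : Disjoint (ballProd m n σ (σ + k * Real.log 2))
        ((Metric.closedBall (0 : EuclideanSpace ℝ (Fin m)) (Real.exp σ)) ×ˢ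
        (Metric.closedBall (0 : EuclideanSpace ℝ (Fin n)) (Real.exp τ) \
          Metric.closedBall 0 (Real.exp τ / 2))) := by
      rw [ballProd, hτ']
      exact Set.disjoint_prod.2 (Or.inr Set.disjoint_sdiff_right)
    rw [heq, lintegral_union
      (measurableSet_closedBall.prod (measurableSet_closedBall.diff measurableSet_closedBall)) hdisj]
    push_cast
    rw [add_mul, one_mul]
    refine add_le_add ih (le_trans (le_of_eq ?_) hann)
    congr 1
    ring

theorem exists_expE_le_lintegral_ballProd (m : ℕ) (hn : 1 ≤ n) (H : ℝ) :
    ∃ θ : ℝ, 0 ≤ θ ∧ expE H ≤ ∫⁻ z in ballProd m n 0 θ, powerWeight m n (-n) z := by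
  obtain ⟨c, hc⟩ := exists_nat_mul_le_lintegral_ballProd m hn
  obtain ⟨k, hk⟩ := exists_nat_ge (Real.exp (H - c))
  have hl : 0 < Real.log 2 := Real.log_pos one_lt_two
  refine ⟨k * Real.log 2, by positivity, ?_⟩
  have h := hc 0 k
  rw [zero_add, mul_zero, add_zero] at h
  refine le_trans ?_ h
  rw [show H = H - c + c by ring, expE_add]
  refine mul_le_mul_left ?_ _
  rw [expE, ← ENNReal.ofReal_natCast]
  exact ENNReal.ofReal_le_ofReal (by simpa using hk)

theorem lintegral_ballProd_eq_top (hm : 1 ≤ m) {κ : ℝ} (hκ : (m : ℝ) + n ≤ κ) :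
    ∫⁻ z in ballProd m n 0 0, powerWeight m n (-κ) z = ⊤ := by
  have : Nonempty (Fin m) := ⟨⟨0, hm⟩⟩
  have hκ0 : 0 ≤ κ := le_trans (by positivity) hκ
  have : (volume : Measure (ProdSpace m n)).IsAddHaarMeasure := by
    rw [Measure.volume_eq_prod]; infer_instance
  have htop : ∫⁻ z in Metric.ball (0 : ProdSpace m n) 1, ENNReal.ofReal ‖z‖ ^ (-κ) = ⊤ := by
    by_contra h
    have := (lintegral_ball_rpow_norm_lt_top_iff (volume : Measure (ProdSpace m n)) κ).1
      (lt_top_iff_ne_top.2 h)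
    simp only [Module.finrank_prod, finrank_euclideanSpace, Fintype.card_fin] at this
    push_cast at this
    linarith
  rw [eq_top_iff]
  calc ⊤ = expE (-κ * Real.log 2) *
        ∫⁻ z in Metric.ball (0 : ProdSpace m n) 1, ENNReal.ofReal ‖z‖ ^ (-κ) := by
        rw [htop, ENNReal.mul_top (expE_pos _).ne']
    _ = ∫⁻ z in Metric.ball (0 : ProdSpace m n) 1,
          expE (-κ * Real.log 2) * ENNReal.ofReal ‖z‖ ^ (-κ) :=
        (lintegral_const_mul' _ _ (expE_ne_top _)).symm
    _ ≤ ∫⁻ z in Metric.ball (0 : ProdSpace m n) 1, powerWeight m n (-κ) z := by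
        refine lintegral_mono fun z => ?_
        -- The norm on the product is the maximum norm, hence the factor 2.
        have h2 : rad z ≤ 2 * ‖z‖ := by
          linarith [rad_le_add z, norm_fst_le z, norm_snd_le z]
        calc _ = ENNReal.ofReal (2 * ‖z‖) ^ (-κ) := by
              rw [ENNReal.ofReal_mul zero_le_two,
                ENNReal.mul_rpow_of_ne_top ENNReal.ofReal_ne_top ENNReal.ofReal_ne_top,
                mul_comm (-κ), ← expE_rpow, expE, Real.exp_log two_pos]
          _ ≤ _ := ENNReal.rpow_le_rpow_of_nonpos (by linarith) (ENNReal.ofReal_le_ofReal h2)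
    _ ≤ _ := by
        refine lintegral_mono_set ?_
        rw [ballProd, Real.exp_zero, closedBall_prod_same]
        exact Metric.ball_subset_closedBall

/-- The bound on logarithmic scale which finiteness of the characteristic gives on products of
centred balls. -/
def BallProdBound (m n : ℕ) (κ₁ κ₂ r₁ r₂ A B : ℝ) : Prop :=
  ∃ M, ∀ σ τ u v : ℝ,
    expE u ≤ ∫⁻ z in ballProd m n σ τ, powerWeight m n (-κ₁) z →
    expE v ≤ ∫⁻ z in ballProd m n σ τ, powerWeight m n (-κ₂) z →
    A * σ + B * τ + u * r₁ + v * r₂ ≤ M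

variable {κ₁ κ₂ r₁ r₂ A B : ℝ}

theorem BallProdBound.comm (h : BallProdBound m n κ₁ κ₂ r₁ r₂ A B) :
    BallProdBound m n κ₂ κ₁ r₂ r₁ A B := by
  obtain ⟨M, hM⟩ := h
  exact ⟨M, fun σ τ u v hu hv => by linarith [hM σ τ v u hv hu]⟩

theorem BallProdBound.swap (h : BallProdBound m n κ₁ κ₂ r₁ r₂ A B) :
    BallProdBound n m κ₁ κ₂ r₁ r₂ B A := by
  obtain ⟨M, hM⟩ := h
  refine ⟨M, fun σ τ u v hu hv => ?_⟩
  rw [ballProd, setLIntegral_powerWeight_swap] at hu hv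
  linarith [hM τ σ u v hu hv]

theorem BallProdBound.lt_add (hm : 1 ≤ m) (hn : 1 ≤ n) (hr₁ : 0 < r₁)
    (h : BallProdBound m n κ₁ κ₂ r₁ r₂ A B) : κ₁ < m + n := by
  by_contra hκ
  obtain ⟨M, hM⟩ := h
  obtain ⟨c, hc⟩ := exists_le_lintegral_ballProd m hn κ₂
  have := hM 0 0 ((M + 1 - c * r₂) / r₁) c
    (by rw [lintegral_ballProd_eq_top hm (not_lt.1 hκ)]; exact le_top)
    (by simpa using hc 0 0 le_rfl)
  rw [div_mul_cancel₀ _ hr₁.ne'] at this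
  linarith

theorem eq_zero_of_forall_mul_le {x c : ℝ} (h : ∀ t : ℝ, x * t ≤ c) : x = 0 := by
  by_contra hx
  have := h ((c + 1) / x)
  rw [mul_div_cancel₀ _ hx] at this
  linarith

theorem nonpos_of_forall_mul_le {x c : ℝ} (h : ∀ t : ℝ, 0 ≤ t → x * t ≤ c) : x ≤ 0 := by
  by_contra! hx
  have h0 := h 0 le_rfl
  have := h ((c + 1) / x) (div_nonneg (by linarith) hx.le)
  rw [mul_div_cancel₀ _ hx.ne'] at this
  linarith

theorem BallProdBound.homogeneous (hn : 1 ≤ n) (h : BallProdBound m n κ₁ κ₂ r₁ r₂ A B) :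
    A + m * (r₁ + r₂) + (B + n * (r₁ + r₂)) = κ₁ * r₁ + κ₂ * r₂ := by
  obtain ⟨M, hM⟩ := h
  obtain ⟨c₁, h₁⟩ := exists_le_lintegral_ballProd m hn κ₁
  obtain ⟨c₂, h₂⟩ := exists_le_lintegral_ballProd m hn κ₂
  refine sub_eq_zero.1 (eq_zero_of_forall_mul_le (c := M - c₁ * r₁ - c₂ * r₂) fun t => ?_)
  linarith [hM t t _ _ (h₁ t t le_rfl) (h₂ t t le_rfl)]

theorem BallProdBound.le (hn : 1 ≤ n) (h : BallProdBound m n κ₁ κ₂ r₁ r₂ A B) :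
    max (κ₁ - n) 0 * r₁ + max (κ₂ - n) 0 * r₂ ≤ A + m * (r₁ + r₂) := by
  obtain ⟨M, hM⟩ := h
  obtain ⟨c₁, h₁⟩ := exists_le_lintegral_ballProd m hn κ₁
  obtain ⟨c₂, h₂⟩ := exists_le_lintegral_ballProd m hn κ₂
  refine sub_nonpos.1 (nonpos_of_forall_mul_le (c := M - c₁ * r₁ - c₂ * r₂) fun t ht => ?_)
  linarith [hM (-t) 0 _ _ (h₁ (-t) 0 (by linarith)) (h₂ (-t) 0 (by linarith))]

/-- If equality held, homogeneity would make the total power of e^τ at σ = 0 vanish, while the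
κ₁-integral tends to infinity with τ. -/
theorem BallProdBound.lt_of_eq (hn : 1 ≤ n) (hr₁ : 0 < r₁)
    (h : BallProdBound m n κ₁ κ₂ r₁ r₂ A B) (hκ : κ₁ = n) :
    max (κ₁ - n) 0 * r₁ + max (κ₂ - n) 0 * r₂ < A + m * (r₁ + r₂) := by
  refine (h.le hn).lt_of_ne fun heq => ?_
  have hsum := h.homogeneous hn
  subst hκ
  obtain ⟨M, hM⟩ := h
  obtain ⟨c, hc⟩ := exists_le_lintegral_ballProd m hn κ₂
  obtain ⟨θ, hθ, hH⟩ := exists_expE_le_lintegral_ballProd m hn ((M + 1 - c * r₂) / r₁)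
  have h1 := hM 0 θ _ _ hH (hc 0 θ hθ)
  rw [div_mul_cancel₀ _ hr₁.ne'] at h1
  rw [sub_self, max_self] at heq
  have h2 : (B + n * r₂ - κ₂ * r₂ + max (κ₂ - n) 0 * r₂) * θ = 0 := by
    rw [show B + n * r₂ - κ₂ * r₂ + max (κ₂ - n) 0 * r₂ = 0 by linarith, zero_mul]
  linarith

end Necessity

/-! ### Local integrability of power weights. -/

theorem locallyIntegrable_powerWeight_iff {m n : ℕ} (hm : 1 ≤ m) (hn : 1 ≤ n) (κ : ℝ) :
    LocallyIntegrable (powerWeight m n (-κ)) ↔ κ < m + n := by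
  refine ⟨fun h => ?_, fun h x => ?_⟩
  · by_contra hκ
    have hK : IsCompact (ballProd m n 0 0) :=
      (isCompact_closedBall _ _).prod (isCompact_closedBall _ _)
    have h2 : ∫⁻ z in ballProd m n 0 0, ‖powerWeight m n (-κ) z‖ₑ < ⊤ :=
      (h.integrableOn_isCompact hK).2
    simp only [enorm_eq_self, lintegral_ballProd_eq_top hm (not_lt.1 hκ)] at h2
    exact lt_irrefl _ h2
  · set ρ := ‖x‖ + 1 with hρ
    have hρ0 : 0 < ρ := by positivity
    obtain ⟨τ, hτ⟩ : ∃ τ, Real.exp τ = 2 * ρ := ⟨_, Real.exp_log (by positivity)⟩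
    set a : EuclideanSpace ℝ (Fin m) := WithLp.toLp 2 fun _ => -ρ
    set b : EuclideanSpace ℝ (Fin n) := WithLp.toLp 2 fun _ => -ρ
    have hsub : Metric.closedBall (0 : ProdSpace m n) ρ ⊆
        cube a (Real.exp τ) ×ˢ cube b (Real.exp τ) := by
      rw [hτ, show (0 : ProdSpace m n) = (0, 0) from rfl, ← closedBall_prod_same]
      exact Set.prod_mono (closedBall_subset_cube ρ) (closedBall_subset_cube ρ)
    refine ⟨_, Filter.mem_of_superset (Metric.isOpen_ball.mem_nhds (show x ∈ Metric.ball 0 ρ from ?_))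
        (Metric.ball_subset_closedBall.trans hsub),
      (measurable_powerWeight m n _).aestronglyMeasurable, ?_⟩
    · simp [hρ]
    -- For equal sides the eccentricity term vanishes, so any admissible e serves; the added 1
    -- covers κ = n.
    obtain ⟨c, hc⟩ := exists_lintegral_powerWeight_le hm hn h (e := max (κ - n) 0 + 1)
      (by linarith [le_max_left (κ - n) 0]) (by positivity) (fun _ => by positivity)
      (rad (a, b) + (m + n) * Real.exp τ - τ)
    have hfin := hc a b τ τ le_rfl fun z hz => by
      have e1 := norm_sub_le_of_mem_cube (Real.exp_pos τ).le hz.1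
        (self_mem_cube a (Real.exp_pos τ).le)
      have e2 := norm_sub_le_of_mem_cube (Real.exp_pos τ).le hz.2
        (self_mem_cube b (Real.exp_pos τ).le)
      rw [sub_add_cancel]
      have e3 := rad_le_rad_add z (a, b)
      have e4 := Real.add_one_le_exp (rad (a, b) + (m + n) * Real.exp τ)
      simp only at e3
      linarith
    simp only [HasFiniteIntegral, enorm_eq_self]
    exact hfin.trans_lt (expE_ne_top _).lt_top

theorem powerWeight_rpow (m n : ℕ) (κ r : ℝ) (z : ProdSpace m n) :
    powerWeight m n κ z ^ r = powerWeight m n (κ * r) z := by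
  rw [powerWeight, powerWeight, ENNReal.rpow_mul]

theorem volume_cube_rpow {k : ℕ} (hk : 1 ≤ k) (a : EuclideanSpace ℝ (Fin k)) (σ α : ℝ) :
    volume (cube a (Real.exp σ)) ^ (α / k - 1) = expE ((α - k) * σ) := by
  have : (k : ℝ) ≠ 0 := by positivity
  rw [volume_cube, expE_rpow]
  congr 1
  field_simp

/-! ### Finiteness of the characteristic in terms of X and Y. -/

section Characteristic

variable {m n : ℕ} {α β γ δ p q : ℝ}

theorem muckenhouptChar_powerWeight (m n : ℕ) (α β γ δ p q : ℝ) :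
    muckenhouptChar m n α β p q (powerWeight m n δ) (powerWeight m n (-γ)) =
      ⨆ (a : EuclideanSpace ℝ (Fin m)) (b : EuclideanSpace ℝ (Fin n))
        (s : ℝ) (_ : 0 < s) (t : ℝ) (_ : 0 < t),
        volume (cube a s) ^ (α / m - 1) * volume (cube b t) ^ (β / n - 1)
          * (∫⁻ z in cube a s ×ˢ cube b t, powerWeight m n (-(γ * q)) z) ^ (1 / q)
          * (∫⁻ z in cube a s ×ˢ cube b t, powerWeight m n (-(δ * p.conjExponent)) z)
            ^ (1 / p.conjExponent) := by
  simp only [muckenhouptChar, powerWeight_rpow, neg_mul, mul_neg]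

theorem muckenhouptChar_lt_top_of_forall (hm : 1 ≤ m) (hn : 1 ≤ n) (hq : 0 < q)
    (hp : 0 < p.conjExponent) {M : ℝ}
    (h : ∀ (a : EuclideanSpace ℝ (Fin m)) (b : EuclideanSpace ℝ (Fin n)) (σ τ : ℝ), ∃ u v,
      ∫⁻ z in cube a (Real.exp σ) ×ˢ cube b (Real.exp τ), powerWeight m n (-(γ * q)) z
        ≤ expE u ∧
      ∫⁻ z in cube a (Real.exp σ) ×ˢ cube b (Real.exp τ),
        powerWeight m n (-(δ * p.conjExponent)) z ≤ expE v ∧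
      (α - m) * σ + (β - n) * τ + u * (1 / q) + v * (1 / p.conjExponent) ≤ M) :
    muckenhouptChar m n α β p q (powerWeight m n δ) (powerWeight m n (-γ)) < ⊤ := by
  rw [muckenhouptChar_powerWeight]
  refine lt_of_le_of_lt ?_ (expE_ne_top M).lt_top
  refine iSup_le fun a => iSup_le fun b => iSup_le fun s => iSup_le fun hs => iSup_le fun t =>
    iSup_le fun ht => ?_
  obtain ⟨σ, rfl⟩ : ∃ σ, Real.exp σ = s := ⟨_, Real.exp_log hs⟩
  obtain ⟨τ, rfl⟩ : ∃ τ, Real.exp τ = t := ⟨_, Real.exp_log ht⟩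
  obtain ⟨u, v, hu, hv, hM⟩ := h a b σ τ
  rw [volume_cube_rpow hm, volume_cube_rpow hn]
  calc _ ≤ expE ((α - m) * σ) * expE ((β - n) * τ) * expE u ^ (1 / q)
        * expE v ^ (1 / p.conjExponent) := by gcongr
    _ ≤ _ := by
        rw [expE_rpow, expE_rpow, ← expE_add, ← expE_add, ← expE_add, expE_le_expE]
        exact hM

theorem ballProdBound_of_muckenhouptChar_lt_top (hm : 1 ≤ m) (hn : 1 ≤ n) (hq : 0 < q)
    (hp : 0 < p.conjExponent)
    (h : muckenhouptChar m n α β p q (powerWeight m n δ) (powerWeight m n (-γ)) < ⊤) :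
    BallProdBound m n (γ * q) (δ * p.conjExponent) (1 / q) (1 / p.conjExponent)
      (α - m) (β - n) := by
  obtain ⟨M, hM⟩ := exists_le_expE h
  rw [muckenhouptChar_powerWeight] at hM
  simp only [iSup_le_iff] at hM
  refine ⟨M - (α - m) * Real.log 2 - (β - n) * Real.log 2, fun σ τ u v hu hv => ?_⟩
  have hM' := hM (WithLp.toLp 2 fun _ => -Real.exp σ) (WithLp.toLp 2 fun _ => -Real.exp τ)
    (Real.exp (Real.log 2 + σ)) (Real.exp_pos _) (Real.exp (Real.log 2 + τ)) (Real.exp_pos _)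
  rw [volume_cube_rpow hm, volume_cube_rpow hn] at hM'
  have hsub : ballProd m n σ τ ⊆
      cube (WithLp.toLp 2 fun _ : Fin m => -Real.exp σ) (Real.exp (Real.log 2 + σ)) ×ˢ
        cube (WithLp.toLp 2 fun _ : Fin n => -Real.exp τ) (Real.exp (Real.log 2 + τ)) := by
    rw [Real.exp_add, Real.exp_add, Real.exp_log two_pos]
    exact Set.prod_mono (closedBall_subset_cube _) (closedBall_subset_cube _)
  have key : expE ((α - m) * (Real.log 2 + σ)) * expE ((β - n) * (Real.log 2 + τ))
      * expE u ^ (1 / q) * expE v ^ (1 / p.conjExponent) ≤ expE M := by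
    refine le_trans ?_ hM'
    gcongr
    · exact hu.trans (lintegral_mono_set hsub)
    · exact hv.trans (lintegral_mono_set hsub)
  rw [expE_rpow, expE_rpow, ← expE_add, ← expE_add, ← expE_add, expE_le_expE] at key
  linarith

theorem muckenhouptChar_lt_top_iff (hm : 1 ≤ m) (hn : 1 ≤ n) (hq : 0 < q)
    (hp : 0 < p.conjExponent) {r₁ r₂ X Y Δm Δn : ℝ} (hr₁ : r₁ = 1 / q)
    (hr₂ : r₂ = 1 / p.conjExponent)
    (hX : X = α - m + m * (r₁ + r₂)) (hY : Y = β - n + n * (r₁ + r₂))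
    (hΔm : Δm = triangleIndex p q γ δ m) (hΔn : Δn = triangleIndex p q γ δ n) :
    muckenhouptChar m n α β p q (powerWeight m n δ) (powerWeight m n (-γ)) < ⊤ ↔
      (γ * q < m + n ∧ δ * p.conjExponent < m + n) ∧ X + Y = γ + δ ∧
        LeStrictIf (IsCritical p q γ δ n) Δn X ∧ LeStrictIf (IsCritical p q γ δ m) Δm Y := by
  have hr₁0 : 0 < r₁ := hr₁ ▸ one_div_pos.2 hq
  have hr₂0 : 0 < r₂ := hr₂ ▸ one_div_pos.2 hp
  have hqr : q * r₁ = 1 := by rw [hr₁]; field_simp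
  have hpr : p.conjExponent * r₂ = 1 := by rw [hr₂]; field_simp
  have hγ : γ * q * r₁ = γ := by rw [mul_assoc, hqr, mul_one]
  have hδ : δ * p.conjExponent * r₂ = δ := by rw [mul_assoc, hpr, mul_one]
  have hΔ : ∀ k : ℕ, triangleIndex p q γ δ k =
      max (γ * q - k) 0 * r₁ + max (δ * p.conjExponent - k) 0 * r₂ := by
    intro k
    rw [max_mul_of_nonneg _ _ hr₁0.le, max_mul_of_nonneg _ _ hr₂0.le, sub_mul, sub_mul, hγ, hδ,
      zero_mul, zero_mul, triangleIndex, hr₁, hr₂, mul_one_div, mul_one_div]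
  have hcrit : ∀ k : ℕ, IsCritical p q γ δ k ↔ γ * q = k ∨ δ * p.conjExponent = k := by
    intro k
    rw [IsCritical, sub_eq_zero, sub_eq_zero, eq_div_iff hq.ne', eq_div_iff hp.ne']
  rw [hΔ] at hΔm hΔn
  constructor
  · intro h
    have hB := ballProdBound_of_muckenhouptChar_lt_top hm hn hq hp h
    rw [← hr₁, ← hr₂] at hB
    have hsum := hB.homogeneous hn
    rw [← hX, ← hY, hγ, hδ] at hsum
    refine ⟨⟨hB.lt_add hm hn hr₁0, hB.comm.lt_add hm hn hr₂0⟩, hsum, ⟨?_, fun hc => ?_⟩,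
      ⟨?_, fun hc => ?_⟩⟩
    · linarith [hB.le hn]
    · rcases (hcrit n).1 hc with hc | hc
      · linarith [hB.lt_of_eq hn hr₁0 hc]
      · linarith [hB.comm.lt_of_eq hn hr₂0 hc]
    · linarith [hB.swap.le hm]
    · rcases (hcrit m).1 hc with hc | hc
      · linarith [hB.swap.lt_of_eq hm hr₁0 hc]
      · linarith [hB.swap.comm.lt_of_eq hm hr₂0 hc]
  · rintro ⟨⟨h1, h2⟩, hsum, ⟨hXle, hXlt⟩, ⟨hYle, hYlt⟩⟩
    rw [hcrit] at hXlt hYlt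
    have hX0 : 0 ≤ X := le_trans (hΔn ▸ by positivity) hXle
    have hY0 : 0 ≤ Y := le_trans (hΔm ▸ by positivity) hYle
    subst hX hY hΔm hΔn
    obtain ⟨M₁, hM₁⟩ := exists_rectangle_bound hm hn hr₁0 hr₂0 h1 h2
      (by rw [hγ, hδ]; exact hsum) hXle hXlt hY0
    obtain ⟨M₂, hM₂⟩ := exists_rectangle_bound hn hm hr₁0 hr₂0 (by linarith) (by linarith)
      (by rw [hγ, hδ, ← hsum]; ring) hYle hYlt hX0
    refine muckenhouptChar_lt_top_of_forall hm hn hq hp (M := max M₁ M₂) fun a b σ τ => ?_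
    rw [← hr₁, ← hr₂]
    rcases le_total σ τ with hst | hst
    · obtain ⟨u, v, hu, hv, hle⟩ := hM₁ a b σ τ hst
      exact ⟨u, v, hu, hv, hle.trans (le_max_left _ _)⟩
    · obtain ⟨u, v, hu, hv, hle⟩ := hM₂ b a τ σ hst
      rw [setLIntegral_powerWeight_swap] at hu hv
      exact ⟨u, v, hu, hv, le_trans (by linarith) (le_max_right _ _)⟩

end Characteristic

/-! ### Translation to the stated conditions. -/

theorem leStrictIf_congr {c : Prop} {A B A' B' : ℝ} (h : A ≤ B ↔ A' ≤ B') (h' : A < B ↔ A' < B') :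
    LeStrictIf c A B ↔ LeStrictIf c A' B' := by
  rw [LeStrictIf, LeStrictIf, h, h']

theorem leStrictIf_add_div {c : Prop} {G D x : ℝ} {k : ℕ} (hk : 1 ≤ k) :
    LeStrictIf c (G + D / k) (x / k) ↔ LeStrictIf c D (x - k * G) := by
  have hk' : (0 : ℝ) < k := by exact_mod_cast hk
  have e : G + D / k = (k * G + D) / k := by field_simp
  rw [e]
  refine leStrictIf_congr ?_ ?_
  · rw [div_le_div_iff_of_pos_right hk', le_sub_iff_add_le']
  · rw [div_lt_div_iff_of_pos_right hk', lt_sub_iff_add_lt']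

theorem leStrictIf_div_add_sub {c : Prop} {G D s x : ℝ} {k : ℕ} (hk : 1 ≤ k) :
    LeStrictIf c (x / k) (G + s / k - D / k) ↔ LeStrictIf c D (s - (x - k * G)) := by
  have hk' : (0 : ℝ) < k := by exact_mod_cast hk
  have e : G + s / k - D / k = (k * G + s - D) / k := by field_simp
  rw [e]
  refine leStrictIf_congr ?_ ?_
  · rw [div_le_div_iff_of_pos_right hk']
    constructor <;> intro h <;> linarith
  · rw [div_lt_div_iff_of_pos_right hk']
    constructor <;> intro h <;> linarith

theorem theoremA (m n : ℕ) (hm : 1 ≤ m) (hn : 1 ≤ n) (p q α β γ δ : ℝ)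
    (hp : 1 < p) (hq : 1 < q) (Γ : ℝ) (hΓ : Γ = 1 / p - 1 / q) :
    (LocallyIntegrable (fun z => powerWeight m n (-γ) z ^ q) ↔ γ * q < m + n) ∧
    (LocallyIntegrable (fun z => powerWeight m n δ z ^ (-p.conjExponent)) ↔
      δ * p.conjExponent < m + n) ∧
    (muckenhouptChar m n α β p q (powerWeight m n δ) (powerWeight m n (-γ)) < ⊤ ↔
      (γ * q < m + n ∧ δ * p.conjExponent < m + n) ∧
      Γ = (α + β - γ - δ) / (m + n) ∧
      (LeStrictIf (IsCritical p q γ δ n)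
          (Γ + triangleIndex p q γ δ n / m) (α / m) ∧
        LeStrictIf (IsCritical p q γ δ m)
          (α / m) (Γ + (γ + δ) / m - triangleIndex p q γ δ m / m)) ∧
      (LeStrictIf (IsCritical p q γ δ m)
          (Γ + triangleIndex p q γ δ m / n) (β / n) ∧
        LeStrictIf (IsCritical p q γ δ n)
          (β / n) (Γ + (γ + δ) / n - triangleIndex p q γ δ n / n))) := by
  have hp' : 0 < p.conjExponent := div_pos (by linarith) (by linarith)
  have hpr : 1 / p.conjExponent = 1 - 1 / p := by
    rw [Real.conjExponent]
    field_simp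
  have hm0 : (1 : ℝ) ≤ m := by exact_mod_cast hm
  have hn0 : (1 : ℝ) ≤ n := by exact_mod_cast hn
  refine ⟨?_, ?_, ?_⟩
  · simp only [powerWeight_rpow, neg_mul]
    exact locallyIntegrable_powerWeight_iff hm hn _
  · simp only [powerWeight_rpow, mul_neg]
    exact locallyIntegrable_powerWeight_iff hm hn _
  rw [muckenhouptChar_lt_top_iff hm hn (by linarith) hp' rfl rfl (X := α - m * Γ)
    (Y := β - n * Γ) (by rw [hpr, hΓ]; ring) (by rw [hpr, hΓ]; ring) rfl rfl]
  simp only [leStrictIf_add_div hm, leStrictIf_add_div hn, leStrictIf_div_add_sub hm,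
    leStrictIf_div_add_sub hn]
  have hsum : Γ = (α + β - γ - δ) / (m + n) ↔ α - m * Γ + (β - n * Γ) = γ + δ := by
    rw [eq_div_iff (by positivity)]
    constructor <;> intro h <;> linarith
  rw [hsum]
  refine and_congr_right fun _ => and_congr_right fun h => ?_
  -- Homogeneity identifies each upper bound with the lower bound for the other variable, so the
  -- four conditions collapse to two.
  rw [show γ + δ - (α - m * Γ) = β - n * Γ by linarith,
    show γ + δ - (β - n * Γ) = α - m * Γ by linarith]
  tauto
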